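/- Let $k$ be an algebraically closed field, $G$ a finite group, $n\ge 2$ an integer, $x\in G$ a central element of order $n$, and $\chi\colon G\to k^\times$ a group homomorphism with $\chi^n=1$ such that $q=\chi(x)$ is a primitive $n$-th root of unity. Let $H$ be the associated monomial Hopf algebra of type I: as an algebra it is generated by the group algebra $kG$ and an element $y$ subject to $y^n=0$ and $yg=\chi(g)\,gy$ for $g\in G$; its Hopf algebra structure is determined by $\Delta(g)=g\otimes g$, $\varepsilon(g)=1$, $S(g)=g^{-1}$ for $g\in G$ and $\Delta(y)=1\otimes y+y\otimes x$, $\varepsilon(y)=0$, $S(y)=-yx^{-1}$. For a normalized two-cocycle $\sigma\colon G\times G\to k^\times$ (trivial action, $\sigma(1,1)=1$) and a scalar $c\in k$, let $A_{\sigma,c}$ be the $k$-algebra generated by $u_y$ and $u_g$ $(g\in G)$ with the relations $$u_1=1,\quad u_gu_h=\sigma(g,h)\,u_{gh},\quad u_y^n=c,\quad u_yu_g=\chi(g)\,u_gu_y\qquad(g,h\in G),$$ regarded as a right $H$-comodule algebra through the algebra map $\delta\colon A_{\sigma,c}\to A_{\sigma,c}\otimes H$ given by $\delta(u_g)=u_g\otimes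 g$ and $\delta(u_y)=1\otimes y+u_y\otimes x$. Let $T=T(X_H)$ be the tensor algebra on a direct sum $X_H=\bigoplus_{i\ge 1}X_i^H$ of countably many copies of $H$, where $h\in H$ corresponds to $X_i^h\in X_i^H$, with the $H$-comodule algebra structure $\delta(X_i^h)=X_i^{h_1}\otimes h_2$, where $\Delta(h)=h_1\otimes h_2$. For an $H$-comodule algebra $A$, let $\mathrm{Id}_H(A)\subset T$ be the intersection of the kernels of all $H$-comodule algebra maps $T\to A$ (the $T$-ideal of polynomial $H$-identities of $A$). **Theorem.** Let $\sigma,\sigma'$ be normalized two-cocycles of $G$ with values in $k^\times$ and let $c,c'\in k$. If $\mathrm{Id}_H(A_{\sigma,c})=\mathrm{Id}_H(A_{\sigma',c'})$, then $A_{\sigma,c}$ and $A_{\sigma',c'}$ are isomorphic $H$-comodule algebras; moreover $c=c'$, and $\sigma$ and $\sigma'$ are cohomologous, i.e. represent the same element of $H^2(G,k^\times)$. -/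

import Mathlib

open scoped TensorProduct

noncomputable section

namespace HopfPI

/-! ### Comodule algebras over a bialgebra and their polynomial identities -/

section Comodule

variable (k H : Type*) [Field k] [Ring H] [Bialgebra k H]

/-- A right `H`-comodule algebra: a unital associative algebra `A` with a coassociative and
counital coaction `A → A ⊗ H` which is an algebra map. -/
class ComoduleAlgebra (A : Type*) [Ring A] [Algebra k A] where
  /-- The coaction. -/
  coaction : A →ₐ[k] A ⊗[k] H
  coassoc : (Algebra.TensorProduct.assoc k k k A H H).toAlgHom.comp
      ((Algebra.TensorProduct.map coaction (AlgHom.id k H)).comp coaction)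
    = (Algebra.TensorProduct.map (AlgHom.id k A) (Bialgebra.comulAlgHom k H)).comp coaction
  counit : (Algebra.TensorProduct.rid k k A).toAlgHom.comp
      ((Algebra.TensorProduct.map (AlgHom.id k A) (Bialgebra.counitAlgHom k H)).comp coaction)
    = AlgHom.id k A

variable {A B : Type*} [Ring A] [Algebra k A] [Ring B] [Algebra k B]
  [ComoduleAlgebra k H A] [ComoduleAlgebra k H B]

/-- An algebra map between `H`-comodule algebras is a comodule algebra map if it commutes with
the coactions. -/
def IsComoduleAlgHom (f : A →ₐ[k] B) : Prop :=
  (ComoduleAlgebra.coaction (k := k) (H := H) (A := B)).comp f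
    = (Algebra.TensorProduct.map f (AlgHom.id k H)).comp
        (ComoduleAlgebra.coaction (k := k) (H := H) (A := A))

variable (A B) in
/-- Two `H`-comodule algebras are isomorphic if there is an algebra isomorphism between them that
commutes with the coactions. -/
def IsomorphicComoduleAlgebras : Prop :=
  ∃ e : A ≃ₐ[k] B, IsComoduleAlgHom k H e.toAlgHom

/-- The tensor algebra `T(X_H)` on the direct sum `X_H` of countably many copies `X_i^H` of `H`:
the non-commutative polynomials in the indeterminates `X_i^h`, which are linear in `h`. -/
abbrev PolyAlgebra : Type _ := TensorAlgebra k (ℕ →₀ H)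

variable {H} in
/-- The indeterminate `X_i^h`. -/
def PolyAlgebra.X (i : ℕ) (h : H) : PolyAlgebra k H :=
  TensorAlgebra.ι k (Finsupp.single i h)

/-- The linear map `h ↦ X_i^h`. -/
def PolyAlgebra.Xₗ (i : ℕ) : H →ₗ[k] PolyAlgebra k H :=
  (TensorAlgebra.ι k).comp (Finsupp.lsingle i)

/-- The coaction `X_i^h ↦ X_i^{h₁} ⊗ h₂` on the generators of `T(X_H)`. -/
def PolyAlgebra.coactionₗ : (ℕ →₀ H) →ₗ[k] PolyAlgebra k H ⊗[k] H :=
  Finsupp.lsum k fun i =>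
    (TensorProduct.map (PolyAlgebra.Xₗ k H i) LinearMap.id).comp Coalgebra.comul

variable {k H} in
theorem PolyAlgebra.algHom_ext {C : Type*} [Ring C] [Algebra k C] {f g : PolyAlgebra k H →ₐ[k] C}
    (h : ∀ i, f.toLinearMap.comp (PolyAlgebra.Xₗ k H i) = g.toLinearMap.comp (PolyAlgebra.Xₗ k H i)) :
    f = g := by
  apply TensorAlgebra.hom_ext
  apply Finsupp.lhom_ext'
  intro i
  exact h i

instance PolyAlgebra.comoduleAlgebra : ComoduleAlgebra k H (PolyAlgebra k H) where
  coaction := TensorAlgebra.lift k (PolyAlgebra.coactionₗ k H)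
  coassoc := by
    apply PolyAlgebra.algHom_ext
    intro i
    have key : (TensorAlgebra.lift k (PolyAlgebra.coactionₗ k H)).toLinearMap.comp
        (PolyAlgebra.Xₗ k H i)
        = (TensorProduct.map (PolyAlgebra.Xₗ k H i) LinearMap.id).comp Coalgebra.comul := by
      ext h
      simp [PolyAlgebra.Xₗ, PolyAlgebra.coactionₗ]
    ext h
    have hk := fun h => LinearMap.congr_fun key h
    simp only [LinearMap.comp_apply, AlgHom.toLinearMap_apply] at hk
    simp only [LinearMap.comp_apply, AlgHom.toLinearMap_apply, AlgHom.comp_apply, hk]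
    have hc := Coalgebra.coassoc_apply (R := k) h
    have h2 : ∀ z : H ⊗[k] H,
        (Algebra.TensorProduct.assoc k k k (PolyAlgebra k H) H H)
          (Algebra.TensorProduct.map (TensorAlgebra.lift k (PolyAlgebra.coactionₗ k H))
            (AlgHom.id k H) (TensorProduct.map (PolyAlgebra.Xₗ k H i) LinearMap.id z))
        = TensorProduct.map (PolyAlgebra.Xₗ k H i) LinearMap.id
            (TensorProduct.assoc k H H H (Coalgebra.comul.rTensor H z)) := by
      intro z
      induction z with
      | zero => simp
      | add a b ha hb => simp only [map_add, ha, hb]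
      | tmul a b =>
        simp only [TensorProduct.map_tmul, Algebra.TensorProduct.map_tmul, hk,
          LinearMap.rTensor_tmul, LinearMap.id_apply, AlgHom.id_apply]
        generalize (Coalgebra.comul (R := k) a) = w
        induction w with
        | zero => simp
        | add a b ha hb => simp only [map_add, TensorProduct.add_tmul, ha, hb]
        | tmul c d => simp
    have h3 : ∀ z : H ⊗[k] H,
        (Algebra.TensorProduct.map (AlgHom.id k (PolyAlgebra k H)) (Bialgebra.comulAlgHom k H))
          (TensorProduct.map (PolyAlgebra.Xₗ k H i) LinearMap.id z)
        = TensorProduct.map (PolyAlgebra.Xₗ k H i) LinearMap.id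
            (Coalgebra.comul.lTensor H z) := by
      intro z
      induction z with
      | zero => simp
      | add a b ha hb => simp only [map_add, ha, hb]
      | tmul a b => simp
    refine (h2 _).trans (Eq.trans ?_ (h3 _).symm)
    rw [hc]
  counit := by
    apply PolyAlgebra.algHom_ext
    intro i
    ext h
    have h2 : ∀ z : H ⊗[k] H,
        (Algebra.TensorProduct.rid k k (PolyAlgebra k H))
          (Algebra.TensorProduct.map (AlgHom.id k (PolyAlgebra k H))
            (Bialgebra.counitAlgHom k H) (TensorProduct.map (PolyAlgebra.Xₗ k H i) LinearMap.id z))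
        = PolyAlgebra.Xₗ k H i (TensorProduct.rid k H (Coalgebra.counit.lTensor H z)) := by
      intro z
      induction z with
      | zero => simp
      | add a b ha hb => simp only [map_add, ha, hb]
      | tmul a b => simp
    have hk : TensorAlgebra.lift k (PolyAlgebra.coactionₗ k H) (PolyAlgebra.Xₗ k H i h)
        = TensorProduct.map (PolyAlgebra.Xₗ k H i) LinearMap.id (Coalgebra.comul h) := by
      simp [PolyAlgebra.Xₗ, PolyAlgebra.coactionₗ]
    simp only [LinearMap.comp_apply, AlgHom.toLinearMap_apply, AlgHom.comp_apply, hk]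
    refine (h2 _).trans ?_
    rw [Coalgebra.lTensor_counit_comul]
    simp

theorem PolyAlgebra.coaction_X (i : ℕ) (h : H) :
    ComoduleAlgebra.coaction (k := k) (H := H) (PolyAlgebra.X k i h)
      = TensorProduct.map (PolyAlgebra.Xₗ k H i) LinearMap.id (Coalgebra.comul h) := by
  simp [ComoduleAlgebra.coaction, PolyAlgebra.X, PolyAlgebra.coactionₗ]

variable (A) in
/-- The ideal `Id_H(A)` of polynomial `H`-identities of `A`: the intersection of the kernels of all
`H`-comodule algebra maps `T(X_H) → A`. -/
def identityIdeal : TwoSidedIdeal (PolyAlgebra k H) :=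
  ⨅ μ : {μ : PolyAlgebra k H →ₐ[k] A // IsComoduleAlgHom k H μ}, TwoSidedIdeal.ker μ.1

theorem mem_identityIdeal {P : PolyAlgebra k H} :
    P ∈ identityIdeal k H A ↔
      ∀ μ : PolyAlgebra k H →ₐ[k] A, IsComoduleAlgHom k H μ → μ P = 0 := by
  simp [identityIdeal, TwoSidedIdeal.mem_iInf, TwoSidedIdeal.mem_ker]

end Comodule

/-! ### The `q`-binomial formula at a primitive root of unity -/

section QBinomial

variable {k : Type*} [Field k]

/-- Gaussian binomial coefficients. -/
def gauss (q : k) : ℕ → ℕ → k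
  | _, 0 => 1
  | 0, _ + 1 => 0
  | m + 1, i + 1 => gauss q m i + q ^ (i + 1) * gauss q m (i + 1)

theorem gauss_succ (q : k) (m i : ℕ) :
    gauss q (m + 1) (i + 1) = gauss q m i + q ^ (i + 1) * gauss q m (i + 1) := rfl

theorem gauss_zero (q : k) (m : ℕ) : gauss q m 0 = 1 := by cases m <;> rfl

theorem gauss_of_lt (q : k) : ∀ (m i : ℕ), m < i → gauss q m i = 0
  | 0, i + 1, _ => rfl
  | m + 1, i + 1, h => by
    rw [gauss, gauss_of_lt q m i (by omega), gauss_of_lt q m (i + 1) (by omega)]; simp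

theorem gauss_self (q : k) : ∀ m : ℕ, gauss q m m = 1
  | 0 => rfl
  | m + 1 => by rw [gauss, gauss_self q m, gauss_of_lt q m (m + 1) (by omega)]; simp

theorem gauss_step (q : k) : ∀ m i d : ℕ, m = i + d →
    (1 - q ^ d) * gauss q m i = (1 - q ^ (i + 1)) * gauss q m (i + 1)
  | 0, i, d, h => by
    obtain ⟨rfl, rfl⟩ : i = 0 ∧ d = 0 := by omega
    simp [gauss]
  | m + 1, 0, d, h => by
    have ih := gauss_step q m 0 m (by omega)
    obtain rfl : d = m + 1 := by omega
    rw [gauss_succ]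
    simp only [gauss_zero] at ih ⊢
    linear_combination (q) * ih
  | m + 1, i + 1, 0, h => by
    rw [gauss_of_lt q (m + 1) (i + 1 + 1) (by omega)]; simp
  | m + 1, i + 1, d + 1, h => by
    have ih1 := gauss_step q m i (d + 1) (by omega)
    have ih2 := gauss_step q m (i + 1) d (by omega)
    rw [gauss_succ, gauss_succ]
    linear_combination ih1 + q ^ (i + 2) * ih2

theorem gauss_eq_zero {q : k} {n : ℕ} (hq : IsPrimitiveRoot q n) :
    ∀ i : ℕ, i + 1 < n → gauss q n (i + 1) = 0
  | i, hi => by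
    have h1 : (1 - q ^ (i + 1)) * gauss q n (i + 1) = 0 := by
      rw [← gauss_step q n i (n - i) (by omega)]
      cases i with
      | zero => simp [hq.pow_eq_one]
      | succ j => rw [gauss_eq_zero hq j (by omega)]; simp
    refine (mul_eq_zero.mp h1).resolve_left fun h => ?_
    exact hq.pow_ne_one_of_pos_of_lt (Nat.succ_ne_zero i) hi (sub_eq_zero.mp h).symm

variable {R : Type*} [Ring R] [Algebra k R]

theorem mul_pow_qcomm {q : k} {u v : R} (h : v * u = q • (u * v)) (i : ℕ) :
    v * u ^ i = q ^ i • (u ^ i * v) := by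
  induction i with
  | zero => simp
  | succ i ih =>
    rw [pow_succ, ← mul_assoc, ih, smul_mul_assoc, mul_assoc, h, mul_smul_comm, smul_smul,
      ← pow_succ, mul_assoc]

theorem add_pow_gauss {q : k} {u v : R} (h : v * u = q • (u * v)) (m : ℕ) :
    (u + v) ^ m = ∑ i ∈ Finset.range (m + 1), gauss q m i • (u ^ i * v ^ (m - i)) := by
  induction m with
  | zero => simp [gauss]
  | succ m ih =>
    rw [pow_succ', ih, Finset.mul_sum, Finset.sum_range_succ' _ (m + 1)]
    have e : ∀ i ∈ Finset.range (m + 1),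
        (u + v) * gauss q m i • (u ^ i * v ^ (m - i))
          = gauss q m i • (u ^ (i + 1) * v ^ (m - i))
            + (q ^ i * gauss q m i) • (u ^ i * v ^ (m + 1 - i)) := by
      intro i hi
      have hi' : m + 1 - i = m - i + 1 := by
        have := Finset.mem_range.mp hi; omega
      rw [mul_smul_comm, add_mul, smul_add, ← mul_assoc, ← mul_assoc, ← pow_succ',
        mul_pow_qcomm h, smul_mul_assoc, smul_smul, mul_assoc _ v, ← pow_succ', hi',
        mul_comm (q ^ i)]
    rw [Finset.sum_congr rfl e, Finset.sum_add_distrib, Finset.sum_range_succ'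
      (fun i => (q ^ i * gauss q m i) • (u ^ i * v ^ (m + 1 - i))) m]
    have e2 : ∀ i ∈ Finset.range (m + 1),
        gauss q (m + 1) (i + 1) • (u ^ (i + 1) * v ^ (m + 1 - (i + 1)))
          = gauss q m i • (u ^ (i + 1) * v ^ (m - i))
            + (q ^ (i + 1) * gauss q m (i + 1)) • (u ^ (i + 1) * v ^ (m - i)) := by
      intro i _
      rw [gauss, add_smul, Nat.add_sub_add_right]
    rw [Finset.sum_congr rfl e2, Finset.sum_add_distrib]
    rw [Finset.sum_range_succ (fun i => (q ^ (i + 1) * gauss q m (i + 1)) •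
      (u ^ (i + 1) * v ^ (m - i))) m, gauss_of_lt q m (m + 1) (by omega)]
    simp [gauss_zero, add_assoc]

theorem mul_pow_of_qcomm {q : k} {u v : R} (h : v * u = q • (u * v)) (m : ℕ) :
    ∃ s : k, (u * v) ^ m = s • (u ^ m * v ^ m) := by
  induction m with
  | zero => exact ⟨1, by simp⟩
  | succ m ih =>
    obtain ⟨s, hs⟩ := ih
    refine ⟨s * q ^ m, ?_⟩
    rw [pow_succ', hs, mul_smul_comm, mul_assoc, ← mul_assoc v, mul_pow_qcomm h, smul_mul_assoc,
      mul_smul_comm, smul_smul, mul_assoc _ v, ← pow_succ', ← mul_assoc u, ← pow_succ']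

/-- If `v u = q u v` with `q` a primitive `n`-th root of unity, then `(u + v)^n = u^n + v^n`. -/
theorem add_pow_of_qcomm {q : k} {n : ℕ} (hn : n ≠ 0) (hq : IsPrimitiveRoot q n) {u v : R}
    (h : v * u = q • (u * v)) : (u + v) ^ n = u ^ n + v ^ n := by
  obtain ⟨m, rfl⟩ := Nat.exists_eq_succ_of_ne_zero hn
  rw [add_pow_gauss h, Finset.sum_range_succ, Finset.sum_range_succ', Finset.sum_eq_zero]
  · simp [gauss_zero, gauss_self, add_comm]
  · intro i hi
    rw [gauss_eq_zero hq i (by have := Finset.mem_range.mp hi; omega), zero_smul]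

end QBinomial

/-! ### Monomial Hopf algebras of type I and their Galois objects -/

/-- The data defining a monomial Hopf algebra of type I: an integer `n ≥ 2`, a central element `x`
of order `n` in the group `G`, and a character `χ` with `χ ^ n = 1` whose value `q = χ x` is a
primitive `n`-th root of unity. -/
structure MonomialDatum (k G : Type*) [Field k] [Group G] where
  n : ℕ
  two_le_n : 2 ≤ n
  x : G
  x_mem_center : x ∈ Subgroup.center G
  orderOf_x : orderOf x = n
  χ : G →* kˣ
  χ_pow : χ ^ n = 1
  isPrimitiveRoot : IsPrimitiveRoot (χ x : k) n

/-- A normalized two-cocycle of `G` with values in `kˣ` (trivial action). The cocycle condition and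
`σ 1 1 = 1` imply `σ g 1 = σ 1 g = 1` for all `g`. -/
structure TwoCocycle (k G : Type*) [Field k] [Group G] where
  toFun : G → G → kˣ
  map_one_one : toFun 1 1 = 1
  cocycle : ∀ g h l : G, toFun g h * toFun (g * h) l = toFun h l * toFun g (h * l)

namespace TwoCocycle

variable {k G : Type*} [Field k] [Group G]

instance : CoeFun (TwoCocycle k G) fun _ => G → G → kˣ := ⟨toFun⟩

/-- The trivial two-cocycle. -/
instance : One (TwoCocycle k G) := ⟨⟨fun _ _ => 1, rfl, fun _ _ _ => rfl⟩⟩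

theorem one_apply (g h : G) : (1 : TwoCocycle k G) g h = 1 := rfl

/-- Two cocycles are cohomologous, i.e. represent the same element of `H²(G, kˣ)`, if they differ
by the coboundary of a function `f : G → kˣ`. -/
def Cohomologous (σ σ' : TwoCocycle k G) : Prop :=
  ∃ f : G → kˣ, ∀ g h : G, σ g h = f g * f h * (f (g * h))⁻¹ * σ' g h

end TwoCocycle

/-- The generators `u_g` (`g ∈ G`) and `u_y`. -/
inductive Gen (G : Type*) : Type _
  | u (g : G) : Gen G
  | y : Gen G

section Monomial

variable {k G : Type*} [Field k] [Group G]

/-- The defining relations of `A_{σ,c}`. -/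
inductive Rel (D : MonomialDatum k G) (σ : TwoCocycle k G) (c : k) :
    FreeAlgebra k (Gen G) → FreeAlgebra k (Gen G) → Prop
  | one : Rel D σ c (FreeAlgebra.ι k (Gen.u 1)) 1
  | mul (g h : G) : Rel D σ c (FreeAlgebra.ι k (Gen.u g) * FreeAlgebra.ι k (Gen.u h))
      ((σ g h : k) • FreeAlgebra.ι k (Gen.u (g * h)))
  | pow : Rel D σ c (FreeAlgebra.ι k Gen.y ^ D.n) (algebraMap k _ c)
  | comm (g : G) : Rel D σ c (FreeAlgebra.ι k Gen.y * FreeAlgebra.ι k (Gen.u g))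
      ((D.χ g : k) • (FreeAlgebra.ι k (Gen.u g) * FreeAlgebra.ι k Gen.y))

/-- The algebra `A_{σ,c}` generated by `u_y` and the `u_g`, `g ∈ G`, subject to `u_1 = 1`,
`u_g u_h = σ(g,h) u_{gh}`, `u_y ^ n = c` and `u_y u_g = χ(g) u_g u_y`. -/
def GaloisObject (D : MonomialDatum k G) (σ : TwoCocycle k G) (c : k) : Type _ :=
  RingQuot (Rel D σ c)

namespace GaloisObject

variable (D : MonomialDatum k G) (σ : TwoCocycle k G) (c : k)

instance : Ring (GaloisObject D σ c) := inferInstanceAs (Ring (RingQuot (Rel D σ c)))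

instance : Algebra k (GaloisObject D σ c) := inferInstanceAs (Algebra k (RingQuot (Rel D σ c)))

/-- The quotient map from the free algebra. -/
def mk : FreeAlgebra k (Gen G) →ₐ[k] GaloisObject D σ c := RingQuot.mkAlgHom k (Rel D σ c)

theorem mk_surjective : Function.Surjective (mk D σ c) := RingQuot.mkAlgHom_surjective k _

variable {D σ c} in
theorem mk_rel {a b : FreeAlgebra k (Gen G)} (h : Rel D σ c a b) : mk D σ c a = mk D σ c b :=
  RingQuot.mkAlgHom_rel k h

/-- The generator `u_g`. -/
def u (g : G) : GaloisObject D σ c := mk D σ c (FreeAlgebra.ι k (Gen.u g))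

/-- The generator `u_y`. -/
def y : GaloisObject D σ c := mk D σ c (FreeAlgebra.ι k Gen.y)

theorem u_one : u D σ c 1 = 1 := by
  simpa [u] using mk_rel (Rel.one (D := D) (σ := σ) (c := c))

theorem u_mul (g h : G) : u D σ c g * u D σ c h = (σ g h : k) • u D σ c (g * h) := by
  simpa [u] using mk_rel (Rel.mul (D := D) (σ := σ) (c := c) g h)

theorem y_pow : y D σ c ^ D.n = algebraMap k _ c := by
  simpa [y] using mk_rel (Rel.pow (D := D) (σ := σ) (c := c))

theorem y_mul_u (g : G) : y D σ c * u D σ c g = (D.χ g : k) • (u D σ c g * y D σ c) := by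
  simpa [y, u] using mk_rel (Rel.comm (D := D) (σ := σ) (c := c) g)

variable {D σ c}

theorem algHom_ext {B : Type*} [Semiring B] [Algebra k B] {f g : GaloisObject D σ c →ₐ[k] B}
    (hu : ∀ a, f (u D σ c a) = g (u D σ c a)) (hy : f (y D σ c) = g (y D σ c)) : f = g := by
  have h : f.comp (mk D σ c) = g.comp (mk D σ c) := by
    apply FreeAlgebra.hom_ext
    funext a
    cases a with
    | u a => exact hu a
    | y => exact hy
  ext a
  obtain ⟨b, rfl⟩ := mk_surjective D σ c a
  exact DFunLike.congr_fun h b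

@[elab_as_elim]
theorem induction {P : GaloisObject D σ c → Prop} (scalar : ∀ r, P (algebraMap k _ r))
    (u : ∀ g, P (u D σ c g)) (y : P (y D σ c)) (add : ∀ a b, P a → P b → P (a + b))
    (mul : ∀ a b, P a → P b → P (a * b)) (a : GaloisObject D σ c) : P a := by
  obtain ⟨b, rfl⟩ := mk_surjective D σ c a
  induction b using FreeAlgebra.induction with
  | grade0 r => rw [AlgHom.commutes]; exact scalar r
  | grade1 a =>
    cases a with
    | u g => exact u g
    | y => exact y
  | mul a b ha hb => rw [map_mul]; exact mul _ _ ha hb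
  | add a b ha hb => rw [map_add]; exact add _ _ ha hb

section lift

variable {B : Type*} [Semiring B] [Algebra k B] (U : G → B) (Y : B) (h1 : U 1 = 1)
  (hm : ∀ g h, U g * U h = (σ g h : k) • U (g * h)) (hp : Y ^ D.n = algebraMap k B c)
  (hc : ∀ g, Y * U g = (D.χ g : k) • (U g * Y))

/-- The universal property of `A_{σ,c}`. -/
def lift : GaloisObject D σ c →ₐ[k] B :=
  RingQuot.liftAlgHom k ⟨FreeAlgebra.lift k fun a => Gen.rec U Y a, by
    intro a b h
    cases h with
    | one => simpa using h1
    | mul g h => simpa using hm g h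
    | pow => simpa using hp
    | comm g => simpa using hc g⟩

@[simp] theorem lift_u (g : G) : lift U Y h1 hm hp hc (u D σ c g) = U g := by
  rw [lift, u, mk]
  erw [RingQuot.liftAlgHom_mkAlgHom_apply]
  simp

@[simp] theorem lift_y : lift U Y h1 hm hp hc (y D σ c) = Y := by
  rw [lift, y, mk]
  erw [RingQuot.liftAlgHom_mkAlgHom_apply]
  simp

end lift

end GaloisObject

/-- The monomial Hopf algebra `H` of type I: generated by the group algebra `kG` and by `y`, subject
to `y ^ n = 0` and `y g = χ(g) g y`. This is the presentation of `A_{σ,c}` for `σ = 1`, `c = 0`. -/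
abbrev MonomialHopf (D : MonomialDatum k G) : Type _ := GaloisObject D 1 0

namespace MonomialHopf

variable (D : MonomialDatum k G)

/-- The element `g` of `G`, viewed in `H`. -/
abbrev of (g : G) : MonomialHopf D := GaloisObject.u D 1 0 g

/-- The generator `y` of `H`. -/
abbrev y : MonomialHopf D := GaloisObject.y D 1 0

theorem of_one : of D 1 = 1 := GaloisObject.u_one D 1 0

theorem of_mul (g h : G) : of D g * of D h = of D (g * h) := by
  rw [of, GaloisObject.u_mul, TwoCocycle.one_apply]; simp

theorem of_pow (g : G) (m : ℕ) : of D g ^ m = of D (g ^ m) := by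
  induction m with
  | zero => rw [pow_zero, pow_zero, of_one]
  | succ m ih => rw [pow_succ, ih, of_mul, pow_succ]

theorem y_pow : y D ^ D.n = 0 := by
  rw [GaloisObject.y_pow, map_zero]

theorem y_mul_of (g : G) : y D * of D g = (D.χ g : k) • (of D g * y D) :=
  GaloisObject.y_mul_u D 1 0 g

theorem of_mul_y (g : G) : of D g * y D = ((D.χ g)⁻¹ : k) • (y D * of D g) := by
  rw [y_mul_of, smul_smul, inv_mul_cancel₀ (Units.ne_zero _), one_smul]

end MonomialHopf

namespace GaloisObject

variable (D : MonomialDatum k G) (σ : TwoCocycle k G) (c : k)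

/-- The algebra map `A_{σ,c} → A_{σ,c} ⊗ H` with `u_g ↦ u_g ⊗ g` and
`u_y ↦ 1 ⊗ y + u_y ⊗ x`. -/
def coactionHom : GaloisObject D σ c →ₐ[k] GaloisObject D σ c ⊗[k] MonomialHopf D :=
  lift (fun g => u D σ c g ⊗ₜ[k] MonomialHopf.of D g)
    (1 ⊗ₜ[k] MonomialHopf.y D + y D σ c ⊗ₜ[k] MonomialHopf.of D D.x)
    (by rw [u_one, MonomialHopf.of_one]; rfl)
    (by
      intro g h
      rw [Algebra.TensorProduct.tmul_mul_tmul, u_mul, MonomialHopf.of_mul,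
        TensorProduct.smul_tmul'])
    (by
      rw [add_comm, add_pow_of_qcomm (q := (D.χ D.x : k)) (by have := D.two_le_n; omega)
        D.isPrimitiveRoot]
      · rw [Algebra.TensorProduct.tmul_pow, Algebra.TensorProduct.tmul_pow, y_pow,
          MonomialHopf.y_pow, MonomialHopf.of_pow, ← D.orderOf_x, pow_orderOf_eq_one,
          MonomialHopf.of_one, TensorProduct.tmul_zero, add_zero]
        rfl
      · rw [Algebra.TensorProduct.tmul_mul_tmul, Algebra.TensorProduct.tmul_mul_tmul, one_mul,
          mul_one, MonomialHopf.y_mul_of, TensorProduct.tmul_smul])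
    (by
      intro g
      rw [add_mul, mul_add, smul_add]
      simp only [Algebra.TensorProduct.tmul_mul_tmul, one_mul, mul_one]
      rw [MonomialHopf.y_mul_of, y_mul_u, MonomialHopf.of_mul, MonomialHopf.of_mul,
        Subgroup.mem_center_iff.mp D.x_mem_center g, TensorProduct.tmul_smul,
        ← TensorProduct.smul_tmul' _ (u D σ c g * y D σ c)])

@[simp] theorem coactionHom_u (g : G) :
    coactionHom D σ c (u D σ c g) = u D σ c g ⊗ₜ[k] MonomialHopf.of D g := lift_u ..

@[simp] theorem coactionHom_y :
    coactionHom D σ c (y D σ c)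
      = 1 ⊗ₜ[k] MonomialHopf.y D + y D σ c ⊗ₜ[k] MonomialHopf.of D D.x := lift_y ..

end GaloisObject

namespace MonomialHopf

variable (D : MonomialDatum k G)

/-- The coproduct of `H`: `Δ(g) = g ⊗ g` and `Δ(y) = 1 ⊗ y + y ⊗ x`. -/
def comulHom : MonomialHopf D →ₐ[k] MonomialHopf D ⊗[k] MonomialHopf D :=
  GaloisObject.coactionHom D 1 0

theorem comulHom_of (g : G) : comulHom D (of D g) = of D g ⊗ₜ[k] of D g :=
  GaloisObject.coactionHom_u D 1 0 g

theorem comulHom_y : comulHom D (y D) = 1 ⊗ₜ[k] y D + y D ⊗ₜ[k] of D D.x :=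
  GaloisObject.coactionHom_y D 1 0

/-- The counit of `H`: `ε(g) = 1` and `ε(y) = 0`. -/
def counitHom : MonomialHopf D →ₐ[k] k :=
  GaloisObject.lift (fun _ => 1) 0 rfl (by intro g h; simp [TwoCocycle.one_apply])
    (by have := D.two_le_n; simp; omega) (by intro g; simp)

theorem counitHom_of (g : G) : counitHom D (of D g) = 1 := GaloisObject.lift_u ..

theorem counitHom_y : counitHom D (y D) = 0 := GaloisObject.lift_y ..

instance : Bialgebra k (MonomialHopf D) :=
  Bialgebra.ofAlgHom (comulHom D) (counitHom D)
    (by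
      apply GaloisObject.algHom_ext
      · intro g; simp [comulHom_of]
      · simp [comulHom_y, comulHom_of, TensorProduct.tmul_add, TensorProduct.add_tmul,
          Algebra.TensorProduct.one_def, add_assoc])
    (by
      apply GaloisObject.algHom_ext
      · intro g; simp [comulHom_of, counitHom_of]
      · simp [comulHom_y, counitHom_y])
    (by
      apply GaloisObject.algHom_ext
      · intro g; simp [comulHom_of, counitHom_of]
      · simp [comulHom_y, counitHom_y, counitHom_of])

theorem comul_eq (a : MonomialHopf D) : Coalgebra.comul (R := k) a = comulHom D a := rfl

theorem counit_eq (a : MonomialHopf D) : Coalgebra.counit (R := k) a = counitHom D a := rfl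

/-- The antipode of `H` as an algebra map to the opposite algebra: `S(g) = g⁻¹` and
`S(y) = - y x⁻¹`. -/
def antipodeHom : MonomialHopf D →ₐ[k] (MonomialHopf D)ᵐᵒᵖ :=
  GaloisObject.lift (fun g => MulOpposite.op (of D g⁻¹))
    (MulOpposite.op (-(y D * of D D.x⁻¹)))
    (by rw [inv_one, of_one]; rfl)
    (by
      intro g h
      rw [← MulOpposite.op_mul, of_mul, TwoCocycle.one_apply, mul_inv_rev]; simp)
    (by
      obtain ⟨s, hs⟩ := mul_pow_of_qcomm (of_mul_y D D.x⁻¹) D.n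
      rw [← MulOpposite.op_pow, neg_pow, hs, y_pow]
      simp)
    (by
      intro g
      rw [← MulOpposite.op_mul, ← MulOpposite.op_mul, ← MulOpposite.op_smul, neg_mul, mul_neg,
        smul_neg, mul_assoc (y D), of_mul, ← mul_inv_rev,
        Subgroup.mem_center_iff.mp D.x_mem_center g, mul_inv_rev, ← of_mul, ← mul_assoc (of D g⁻¹),
        of_mul_y, smul_mul_assoc, mul_assoc]
      simp)

theorem antipodeHom_of (g : G) : antipodeHom D (of D g) = MulOpposite.op (of D g⁻¹) :=
  GaloisObject.lift_u ..

theorem antipodeHom_y : antipodeHom D (y D) = MulOpposite.op (-(y D * of D D.x⁻¹)) :=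
  GaloisObject.lift_y ..

/-- The antipode of `H` as a linear map. -/
def antipodeₗ : MonomialHopf D →ₗ[k] MonomialHopf D :=
  (MulOpposite.opLinearEquiv k).symm.toLinearMap.comp (antipodeHom D).toLinearMap

theorem antipodeₗ_mul (a b : MonomialHopf D) :
    antipodeₗ D (a * b) = antipodeₗ D b * antipodeₗ D a := by
  simp [antipodeₗ]

theorem antipodeₗ_one : antipodeₗ D 1 = 1 := by
  simp [antipodeₗ]

theorem antipodeₗ_of (g : G) : antipodeₗ D (of D g) = of D g⁻¹ := by
  simp [antipodeₗ, antipodeHom_of]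

theorem antipodeₗ_y : antipodeₗ D (y D) = -(y D * of D D.x⁻¹) := by
  simp [antipodeₗ, antipodeHom_y]

theorem antipode_left_mul {z w : MonomialHopf D ⊗[k] MonomialHopf D} {r : k}
    (hz : LinearMap.mul' k _ ((antipodeₗ D).rTensor _ z) = algebraMap k _ r) :
    LinearMap.mul' k _ ((antipodeₗ D).rTensor _ (z * w))
      = r • LinearMap.mul' k _ ((antipodeₗ D).rTensor _ w) := by
  induction w with
  | zero => simp
  | add a b ha hb => simp only [mul_add, map_add, ha, hb, smul_add]
  | tmul a b =>
    have key : ∀ z : MonomialHopf D ⊗[k] MonomialHopf D,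
        LinearMap.mul' k _ ((antipodeₗ D).rTensor _ (z * a ⊗ₜ[k] b))
          = antipodeₗ D a * LinearMap.mul' k _ ((antipodeₗ D).rTensor _ z) * b := by
      intro z
      induction z with
      | zero => simp
      | add p q hp hq => simp only [add_mul, mul_add, map_add, hp, hq]
      | tmul p q => simp [antipodeₗ_mul, mul_assoc]
    rw [key, hz, ← Algebra.commutes, mul_assoc, ← Algebra.smul_def]
    simp

theorem antipode_right_mul {z w : MonomialHopf D ⊗[k] MonomialHopf D} {r : k}
    (hw : LinearMap.mul' k _ ((antipodeₗ D).lTensor _ w) = algebraMap k _ r) :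
    LinearMap.mul' k _ ((antipodeₗ D).lTensor _ (z * w))
      = r • LinearMap.mul' k _ ((antipodeₗ D).lTensor _ z) := by
  induction z with
  | zero => simp
  | add a b ha hb => simp only [add_mul, map_add, ha, hb, smul_add]
  | tmul a b =>
    have key : ∀ w : MonomialHopf D ⊗[k] MonomialHopf D,
        LinearMap.mul' k _ ((antipodeₗ D).lTensor _ (a ⊗ₜ[k] b * w))
          = a * LinearMap.mul' k _ ((antipodeₗ D).lTensor _ w) * antipodeₗ D b := by
      intro w
      induction w with
      | zero => simp
      | add p q hp hq => simp only [add_mul, mul_add, map_add, hp, hq]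
      | tmul p q => simp [antipodeₗ_mul, mul_assoc]
    rw [key, hw, ← Algebra.commutes, mul_assoc, ← Algebra.smul_def]
    simp

/-- `H` is a Hopf algebra. -/
instance : HopfAlgebra k (MonomialHopf D) where
  antipode := antipodeₗ D
  mul_antipode_rTensor_comul := by
    ext a
    simp only [LinearMap.comp_apply, comul_eq, counit_eq, Algebra.linearMap_apply]
    induction a using GaloisObject.induction with
    | scalar r =>
      simp only [AlgHom.commutes, Algebra.TensorProduct.algebraMap_apply, LinearMap.rTensor_tmul,
        LinearMap.mul'_apply, mul_one]
      simp [Algebra.algebraMap_eq_smul_one, antipodeₗ_one]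
    | u g => rw [comulHom_of, counitHom_of]; simp [antipodeₗ_of, of_mul, of_one]
    | y =>
      rw [comulHom_y, counitHom_y]
      simp [antipodeₗ_y, antipodeₗ_one, of_mul, of_one, mul_assoc]
    | add a b ha hb => simp only [map_add, ha, hb]
    | mul a b ha hb =>
      rw [map_mul, antipode_left_mul D ha, hb, map_mul, map_mul, Algebra.smul_def]
  mul_antipode_lTensor_comul := by
    ext a
    simp only [LinearMap.comp_apply, comul_eq, counit_eq, Algebra.linearMap_apply]
    induction a using GaloisObject.induction with
    | scalar r =>
      simp only [AlgHom.commutes, Algebra.TensorProduct.algebraMap_apply, LinearMap.lTensor_tmul,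
        LinearMap.mul'_apply, mul_one, antipodeₗ_one]
      simp
    | u g => rw [comulHom_of, counitHom_of]; simp [antipodeₗ_of, of_mul, of_one]
    | y =>
      rw [comulHom_y, counitHom_y]
      simp [antipodeₗ_y, antipodeₗ_of]
    | add a b ha hb => simp only [map_add, ha, hb]
    | mul a b ha hb =>
      rw [map_mul, antipode_right_mul D hb, ha, map_mul, map_mul, Algebra.smul_def, Algebra.commutes]

end MonomialHopf

namespace GaloisObject

variable (D : MonomialDatum k G) (σ : TwoCocycle k G) (c : k)

instance : ComoduleAlgebra k (MonomialHopf D) (GaloisObject D σ c) where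
  coaction := coactionHom D σ c
  coassoc := by
    apply algHom_ext
    · intro g
      simp [MonomialHopf.comul_eq, MonomialHopf.comulHom_of]
    · simp [MonomialHopf.comul_eq, MonomialHopf.comulHom_y, MonomialHopf.comulHom_of,
        TensorProduct.tmul_add, TensorProduct.add_tmul, Algebra.TensorProduct.one_def, add_assoc]
  counit := by
    apply algHom_ext
    · intro g; simp [MonomialHopf.counit_eq, MonomialHopf.counitHom_of]
    · simp [MonomialHopf.counit_eq, MonomialHopf.counitHom_y, MonomialHopf.counitHom_of]

end GaloisObject

end Monomial

end HopfPI

end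

noncomputable section

namespace HopfPI

/-! ### Cocycles evaluated on words -/

/-! ### Extending homomorphisms into the divisible group `kˣ`. -/

section Divisible

/-! Comodule algebra maps from the polynomial algebra to `A_{σ,c}` are very rigid. Each `X_i^g` goes
to a multiple `t_g u_g`, and `X_i^y` goes to `t u_y + r u_x`, with `t` the scalar of `X_i^1`.
Conversely, the monomial basis gives one explicit map with all `t_g = 1` and `r = 0` (`evalHom`). So
identities are checked by cancelling the unknown scalars, and tested by evaluating at that one map.

The cocycle: if two words in `G` are permutations of each other and have the same product, their
values differ by a ratio depending only on `σ`, which gives a binomial identity. Testing it in the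
other algebra shows that `σ/σ'` takes equal values on the two words. This says exactly that `(g,h) ↦
σ(g,h)/σ'(g,h)` vanishes on the kernel of `(g,h) ↦ g + h - gh` from `ℤ[G × G]` to `ℤ[G]`. As `kˣ` is
divisible, it factors through a homomorphism `ℤ[G] → kˣ`, whose values on `G` form the cochain
bounding `σ/σ'` (`cohomologous_of_word`).

The scalar: the commutator of `X^x` and `X^y` eliminates `r`, and its `n`-th power is `c` times a
nonzero constant, depending only on the datum, times `(X^1)^n (X^x)^n` modulo identities. Hence `c`
can be read off (`scalar_eq_of_le`). With equal scalars and cohomologous cocycles, rescaling the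
`u_g` is an isomorphism. -/

/-- A divisible group is injective: `Ψ` descends to `M / ker Φ`, which embeds in `N`, and extends
along this embedding. -/
theorem exists_extension_of_ker_le {M N Q : Type*} [AddCommGroup M] [AddCommGroup N]
    [AddCommGroup Q] [DivisibleBy Q ℤ] (Φ : M →ₗ[ℤ] N) (Ψ : M →ₗ[ℤ] Q)
    (h : LinearMap.ker Φ ≤ LinearMap.ker Ψ) : ∃ F : N →ₗ[ℤ] Q, F ∘ₗ Φ = Ψ := by
  obtain ⟨F, hF⟩ := (Module.Baer.of_divisible Q).extension_property
    ((LinearMap.ker Φ).liftQ Φ le_rfl)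
    (LinearMap.ker_eq_bot.mp (Submodule.ker_liftQ_eq_bot _ _ _ le_rfl))
    ((LinearMap.ker Φ).liftQ Ψ h)
  refine ⟨F, LinearMap.ext fun m => ?_⟩
  simpa using LinearMap.congr_fun hF ((LinearMap.ker Φ).mkQ m)

/-- The unit group of an algebraically closed field is divisible. -/
instance unitsDivisible {k : Type*} [Field k] [IsAlgClosed k] :
    DivisibleBy (Additive kˣ) ℤ :=
  letI : RootableBy kˣ ℕ := rootableByOfPowLeftSurj kˣ ℕ fun {n} hn a => by
    obtain ⟨z, hz⟩ := IsAlgClosed.exists_pow_nat_eq (a : k) (Nat.pos_of_ne_zero hn)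
    have hz0 : z ≠ 0 := by
      rintro rfl
      exact a.ne_zero (by rw [← hz, zero_pow hn])
    exact ⟨Units.mk0 z hz0, Units.ext (by simpa using hz)⟩
  letI : RootableBy kˣ ℤ := Group.rootableByIntOfRootableByNat kˣ
  { div := fun a n => Additive.ofMul (RootableBy.root a.toMul n)
    div_zero := fun a => congrArg Additive.ofMul (RootableBy.root_zero a.toMul)
    div_cancel := fun a hn => congrArg Additive.ofMul (RootableBy.root_cancel a.toMul hn) }

end Divisible

/-! ### Letter counts of words and the cohomology criterion. -/

namespace TwoCocycle

/-- The number of occurrences of each element in a word. -/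
def count {α : Type*} (l : List α) : α →₀ ℤ := (l.map fun g => Finsupp.single g (1 : ℤ)).sum

theorem count_append {α : Type*} (l m : List α) : count (l ++ m) = count l + count m := by
  simp [count]

theorem count_apply {α : Type*} [DecidableEq α] (l : List α) (g : α) : count l g = l.count g := by
  induction l with
  | nil => simp [count]
  | cons h l ih =>
    simp only [count, List.map_cons, List.sum_cons, Finsupp.add_apply, List.count_cons] at ih ⊢
    rw [ih, Finsupp.single_apply]
    by_cases hg : h = g <;> simp [hg, add_comm]

theorem perm_of_count_eq {α : Type*} {l m : List α} (h : count l = count m) : l.Perm m := by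
  classical
  rw [List.perm_iff_count]
  intro g
  have := DFunLike.congr_fun h g
  simpa [count_apply] using this

/-- Splitting each coefficient into positive and negative parts translates relations in a free
abelian group into statements about words. -/
theorem exists_eq_sub {α : Type*} (z : α →₀ ℤ) : ∃ l m : List α,
    z = (l.map fun p => Finsupp.single p (1 : ℤ)).sum
      - (m.map fun p => Finsupp.single p (1 : ℤ)).sum := by
  induction z using Finsupp.induction_linear with
  | zero => exact ⟨[], [], by simp⟩
  | add a b ha hb =>
    obtain ⟨l, m, rfl⟩ := ha
    obtain ⟨l', m', rfl⟩ := hb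
    refine ⟨l ++ l', m ++ m', ?_⟩
    simp only [List.map_append, List.sum_append]
    abel
  | single a b =>
    refine ⟨List.replicate b.toNat a, List.replicate (-b).toNat a, ?_⟩
    simp only [List.map_replicate, List.sum_replicate, ← Finsupp.single_sub, Finsupp.smul_single]
    congr 1
    simp

variable {k G : Type*} [Field k] [Group G] (σ σ' : TwoCocycle k G)

theorem map_one_right (g : G) : σ g 1 = 1 := by
  have h := σ.cocycle g 1 1
  simp only [mul_one, σ.map_one_one, one_mul] at h
  simpa using h

theorem map_one_left (g : G) : σ 1 g = 1 := by
  have h := σ.cocycle 1 1 g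
  simp only [one_mul, σ.map_one_one] at h
  simpa using h.symm

/-- The scalar `s` such that `u_{g₁} ⋯ u_{gᵣ} = s u_{g₁ ⋯ gᵣ}`. -/
def word : List G → kˣ
  | [] => 1
  | g :: l => σ g l.prod * word l

/-- The word `g₁ h₁ ⋯ gᵣ hᵣ` of a list of pairs. -/
def expand : List (G × G) → List G
  | [] => []
  | p :: l => p.1 :: p.2 :: expand l

/-- The word `(g₁ h₁) ⋯ (gᵣ hᵣ)` of a list of pairs. -/
def contract (l : List (G × G)) : List G := l.map fun p => p.1 * p.2

theorem prod_expand (l : List (G × G)) : (expand l).prod = (contract l).prod := by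
  induction l with
  | nil => rfl
  | cons p l ih => simpa [expand, contract, mul_assoc] using ih

/-- Merging adjacent letters `g`, `h` into `gh` costs exactly `σ(g,h)`: this is the cocycle identity
with the product of the remaining letters as third argument. -/
theorem word_expand_append (l : List (G × G)) (m : List G) :
    σ.word (expand l ++ m) = (l.map fun p => σ p.1 p.2).prod * σ.word (contract l ++ m) := by
  induction l with
  | nil => simp [expand, contract]
  | cons p l ih =>
    have h := σ.cocycle p.1 p.2 ((contract l).prod * m.prod)
    simp only [expand, contract, List.cons_append, List.map_cons, List.prod_cons, word,
      List.prod_append] at ih h ⊢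
    rw [prod_expand, contract, ih]
    calc _ = (σ p.2 ((contract l).prod * m.prod) * σ p.1 (p.2 * ((contract l).prod * m.prod)))
          * ((l.map fun p => σ p.1 p.2).prod * σ.word (contract l ++ m)) := by
            simp only [contract]; ac_rfl
      _ = _ := by
        simp only [contract] at h ⊢
        rw [← h]; ac_rfl

theorem word_append_expand (l : List G) (m : List (G × G)) :
    σ.word (l ++ expand m) = (m.map fun p => σ p.1 p.2).prod * σ.word (l ++ contract m) := by
  induction l with
  | nil => simpa using σ.word_expand_append m []
  | cons g l ih =>
    simp only [List.cons_append, word, ih, List.prod_append, prod_expand]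
    ac_rfl

/-- The `ℤ`-linear map `(g, h) ↦ g + h - g h`. -/
def boundary : (G × G →₀ ℤ) →ₗ[ℤ] (G →₀ ℤ) :=
  Finsupp.linearCombination ℤ fun p =>
    Finsupp.single p.1 1 + Finsupp.single p.2 1 - Finsupp.single (p.1 * p.2) 1

/-- The `ℤ`-linear map `(g, h) ↦ σ(g, h) σ'(g, h)⁻¹`. -/
def ratio : (G × G →₀ ℤ) →ₗ[ℤ] Additive kˣ :=
  Finsupp.linearCombination ℤ fun p => Additive.ofMul (σ p.1 p.2 * (σ' p.1 p.2)⁻¹)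

theorem boundary_sum (l : List (G × G)) :
    boundary (l.map fun p => Finsupp.single p (1 : ℤ)).sum
      = count (expand l) - count (contract l) := by
  induction l with
  | nil => simp [expand, contract, count]
  | cons p l ih =>
    simp only [List.map_cons, List.sum_cons, map_add, ih]
    simp [boundary, expand, contract, count]
    abel

theorem ratio_sum (l : List (G × G)) :
    ratio σ σ' (l.map fun p => Finsupp.single p (1 : ℤ)).sum
      = Additive.ofMul ((l.map fun p => σ p.1 p.2).prod * (l.map fun p => σ' p.1 p.2).prod⁻¹) := by
  induction l with
  | nil => simp
  | cons p l ih =>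
    simp only [List.map_cons, List.sum_cons, map_add, ih, List.prod_cons]
    simp only [ratio, Finsupp.linearCombination_single, one_smul, ← ofMul_mul, mul_inv]
    congr 1
    ac_rfl

/-- Two cocycles whose ratio takes the same value on words that are permutations of each other and
have the same product are cohomologous. -/
theorem cohomologous_of_word [IsAlgClosed k]
    (h : ∀ l m : List G, l.Perm m → l.prod = m.prod →
      σ.word l * σ'.word m = σ.word m * σ'.word l) : σ.Cohomologous σ' := by
  obtain ⟨F, hF⟩ := exists_extension_of_ker_le (boundary (G := G)) (ratio σ σ') (by
    intro z hz
    rw [LinearMap.mem_ker] at hz ⊢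
    obtain ⟨l, m, rfl⟩ := exists_eq_sub z
    rw [map_sub, boundary_sum, boundary_sum] at hz
    -- That `z` lies in the kernel says that these two words have the same letters. Their products
    -- agree because merging pairs does not change a product.
    have key := h (expand l ++ contract m) (contract l ++ expand m)
      (perm_of_count_eq (by
        rw [count_append, count_append]
        rw [sub_eq_zero, sub_eq_sub_iff_add_eq_add] at hz
        rw [hz, add_comm]))
      (by simp [prod_expand])
    rw [word_expand_append, word_expand_append, word_append_expand, word_append_expand] at key
    rw [map_sub, ratio_sum, ratio_sum, sub_eq_zero]
    congr 1
    rw [← div_eq_mul_inv, ← div_eq_mul_inv, div_eq_div_iff_mul_eq_mul]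
    -- After merging all pairs, both sides carry the values of the same word `contract l ++ contract
    -- m`.
    refine mul_right_cancel (b := σ.word (contract l ++ contract m) *
      σ'.word (contract l ++ contract m)) ?_
    calc _ = _ := by ac_rfl
      _ = _ := key
      _ = _ := by ac_rfl)
  refine ⟨fun g => (F (Finsupp.single g 1)).toMul, fun g h => ?_⟩
  have := congrArg Additive.toMul (LinearMap.congr_fun hF (Finsupp.single (g, h) 1))
  simp only [LinearMap.comp_apply, boundary, ratio, Finsupp.linearCombination_single, one_smul,
    map_sub, map_add, toMul_sub, toMul_add, toMul_ofMul] at this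
  rw [← div_eq_mul_inv, this]
  simp

end TwoCocycle

variable {k G : Type*} [Field k] [Group G]

/-! ### The monomial basis of `A_{σ,c}` -/

namespace GaloisObject

variable (D : MonomialDatum k G) (σ : TwoCocycle k G) (c : k)

theorem n_ne_zero : D.n ≠ 0 := by have := D.two_le_n; omega

/-- The algebra `k[X] / (Xⁿ - c)`. -/
abbrev RootAlgebra : Type _ := AdjoinRoot (Polynomial.X ^ D.n - Polynomial.C c)

/-- The class of `X` in `k[X] / (Xⁿ - c)`. -/
def root : RootAlgebra D c := AdjoinRoot.root (Polynomial.X ^ D.n - Polynomial.C c)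

theorem root_pow : root D c ^ D.n = algebraMap k (RootAlgebra D c) c := by
  have h := AdjoinRoot.eval₂_root (Polynomial.X ^ D.n - Polynomial.C c)
  simpa [root, sub_eq_zero] using h

theorem linearIndependent_root_pow : LinearIndependent k fun j : Fin D.n =>
    root D c ^ (j : ℕ) := by
  have hm := Polynomial.monic_X_pow_sub_C c (n_ne_zero D)
  have h := (AdjoinRoot.powerBasis' hm).basis.linearIndependent
  have hd : D.n = (AdjoinRoot.powerBasis' hm).dim := by
    rw [AdjoinRoot.powerBasis'_dim, Polynomial.natDegree_X_pow_sub_C]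
  have h2 := h.comp (Fin.cast hd) (Fin.cast_injective hd)
  have e : (fun j : Fin D.n => root D c ^ (j : ℕ))
      = (AdjoinRoot.powerBasis' hm).basis ∘ Fin.cast hd := by
    funext j
    simp [root]
  rw [e]
  exact h2

/-- The action of `u_g` on `G →₀ k[X] / (Xⁿ - c)`. -/
def repU (g : G) : Module.End k (G →₀ RootAlgebra D c) :=
  Finsupp.lsum k fun h => (σ g h : k) • Finsupp.lsingle (g * h)

/-- The action of `u_y` on `G →₀ k[X] / (Xⁿ - c)`. -/
def repY : Module.End k (G →₀ RootAlgebra D c) :=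
  Finsupp.lsum k fun h => (D.χ h : k) • (Finsupp.lsingle h).comp
    (LinearMap.mulLeft k (root D c))

theorem repU_single (g h : G) (w : RootAlgebra D c) :
    repU D σ c g (Finsupp.single h w) = (σ g h : k) • Finsupp.single (g * h) w := by
  simp [repU]

theorem repY_single (h : G) (w : RootAlgebra D c) :
    repY D c (Finsupp.single h w) = (D.χ h : k) • Finsupp.single h
      (root D c * w) := by
  simp [repY]

theorem repY_pow_single (h : G) (w : RootAlgebra D c) (j : ℕ) :
    (repY D c ^ j) (Finsupp.single h w) = (D.χ h : k) ^ j • Finsupp.single h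
      (root D c ^ j * w) := by
  induction j with
  | zero => simp
  | succ j ih =>
    rw [pow_succ', Module.End.mul_apply, ih, map_smul, repY_single, smul_smul, pow_succ,
      pow_succ', mul_assoc]

/-- A representation of `A_{σ,c}` on `G →₀ k[X] / (Xⁿ - c)`. -/
def rep : GaloisObject D σ c →ₐ[k] Module.End k (G →₀ RootAlgebra D c) :=
  lift (repU D σ c) (repY D c)
    (by
      refine Finsupp.lhom_ext fun h w => ?_
      rw [repU_single, TwoCocycle.map_one_left]; simp)
    (by
      intro g h
      refine Finsupp.lhom_ext fun l w => ?_
      rw [Module.End.mul_apply, repU_single, map_smul, repU_single, LinearMap.smul_apply,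
        repU_single, smul_smul, smul_smul, mul_assoc]
      congr 1
      have := σ.cocycle g h l
      rw [← Units.val_mul, ← Units.val_mul, this])
    (by
      refine Finsupp.lhom_ext fun h w => ?_
      -- The twist by `χ(h)` disappears in the `n`-th power, so `u_y ^ n` acts as the scalar `c`.
      have h1 : (D.χ h : k) ^ D.n = 1 := by
        rw [← Units.val_pow_eq_pow_val, ← MonoidHom.pow_apply, D.χ_pow]; simp
      rw [repY_pow_single, h1, one_smul, root_pow, ← Algebra.smul_def,
        Module.algebraMap_end_apply, Finsupp.smul_single])
    (by
      intro g
      refine Finsupp.lhom_ext fun h w => ?_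
      rw [Module.End.mul_apply, LinearMap.smul_apply, Module.End.mul_apply, repU_single, map_smul,
        repY_single, repY_single, map_smul, repU_single, map_mul]
      simp only [smul_smul, Units.val_mul]
      congr 1
      ring)

theorem rep_apply (g : G) (j : ℕ) :
    rep D σ c (u D σ c g * y D σ c ^ j) (Finsupp.single 1 1) = Finsupp.single g
      (root D c ^ j) := by
  rw [map_mul, map_pow, rep, lift_u, lift_y, Module.End.mul_apply, repY_pow_single, map_smul,
    repU_single, TwoCocycle.map_one_right]
  simp

/-- The monomials `u_g u_y ^ j`. -/
def monomial (p : G × Fin D.n) : GaloisObject D σ c := u D σ c p.1 * y D σ c ^ (p.2 : ℕ)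

/-- The representation is left multiplication written in the expected basis. Applied to the vector
that represents `1`, the monomial `u_g u_y ^ j` gives the class of `X ^ j` placed at `g`, and these
vectors are independent. -/
theorem linearIndependent_monomial : LinearIndependent k (monomial D σ c) := by
  refine LinearIndependent.of_comp
    ((LinearMap.applyₗ (Finsupp.single 1 1)).comp (rep D σ c).toLinearMap) ?_
  have h := Finsupp.linearIndependent_single (R := k) (ι := G) (M := RootAlgebra D c)
    (φ := fun _ => Fin D.n)
    (f := fun _ j => root D c ^ (j : ℕ))
    (fun _ => linearIndependent_root_pow D c)
  have h2 := h.comp _ (Equiv.sigmaEquivProd G (Fin D.n)).symm.injective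
  have e : ⇑((LinearMap.applyₗ (Finsupp.single 1 1)).comp (rep D σ c).toLinearMap) ∘ monomial D σ c
      = (fun p : (_ : G) × Fin D.n => Finsupp.single p.1 (root D c ^ (p.2 : ℕ)))
        ∘ (Equiv.sigmaEquivProd G (Fin D.n)).symm :=
    funext fun p => rep_apply D σ c p.1 p.2
  rw [e]
  exact h2

theorem u_mul_y_pow_mem (g : G) (j : ℕ) :
    u D σ c g * y D σ c ^ j ∈ Submodule.span k (Set.range (monomial D σ c)) := by
  have hn := Nat.pos_of_ne_zero (n_ne_zero D)
  -- Since `u_y ^ n = c`, the exponent reduces modulo `n` at the cost of a power of `c`.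
  rw [← Nat.div_add_mod j D.n, pow_add, pow_mul, y_pow, ← map_pow, ← Algebra.smul_def,
    mul_smul_comm]
  exact Submodule.smul_mem _ _ (Submodule.subset_span ⟨(g, ⟨j % D.n, Nat.mod_lt _ hn⟩), rfl⟩)

theorem y_pow_mul_u (g : G) (j : ℕ) :
    y D σ c ^ j * u D σ c g = (D.χ g : k) ^ j • (u D σ c g * y D σ c ^ j) := by
  induction j with
  | zero => simp
  | succ j ih =>
    rw [pow_succ', mul_assoc, ih, mul_smul_comm, ← mul_assoc, y_mul_u, smul_mul_assoc, smul_smul,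
      mul_assoc, ← pow_succ', ← pow_succ]

theorem span_monomial : Submodule.span k (Set.range (monomial D σ c)) = ⊤ := by
  have hone : (1 : GaloisObject D σ c) ∈ Submodule.span k (Set.range (monomial D σ c)) := by
    simpa [u_one] using u_mul_y_pow_mem D σ c 1 0
  rw [eq_top_iff]
  intro a _
  induction a using induction with
  | scalar r =>
    rw [Algebra.algebraMap_eq_smul_one]
    exact Submodule.smul_mem _ _ hone
  | u g => simpa using u_mul_y_pow_mem D σ c g 0
  | y => simpa [u_one] using u_mul_y_pow_mem D σ c 1 1
  | add a b ha hb => exact Submodule.add_mem _ (ha trivial) (hb trivial)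
  | mul a b ha hb =>
    refine Submodule.span_induction₂ (p := fun a b _ _ => a * b ∈
      Submodule.span k (Set.range (monomial D σ c))) ?_ ?_ ?_ ?_ ?_ ?_ ?_
      (ha trivial) (hb trivial)
    · rintro _ _ ⟨p, rfl⟩ ⟨r, rfl⟩
      have h : monomial D σ c p * monomial D σ c r = ((D.χ r.1 : k) ^ (p.2 : ℕ) * σ p.1 r.1) •
          (u D σ c (p.1 * r.1) * y D σ c ^ ((p.2 : ℕ) + r.2)) := by
        rw [monomial, monomial, mul_assoc, ← mul_assoc (_ ^ _), y_pow_mul_u, smul_mul_assoc,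
          mul_smul_comm, mul_assoc, ← mul_assoc, u_mul, smul_mul_assoc, smul_smul, pow_add]
      rw [h]
      exact Submodule.smul_mem _ _ (u_mul_y_pow_mem D σ c _ _)
    · intro b _; simp
    · intro a _; simp
    · intro a b d _ _ _ h1 h2; rw [add_mul]; exact Submodule.add_mem _ h1 h2
    · intro a b d _ _ _ h1 h2; rw [mul_add]; exact Submodule.add_mem _ h1 h2
    · intro r a b _ _ h; rw [smul_mul_assoc]; exact Submodule.smul_mem _ _ h
    · intro r a b _ _ h; rw [mul_smul_comm]; exact Submodule.smul_mem _ _ h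

/-- The basis `u_g u_y ^ j`, `g ∈ G`, `0 ≤ j < n`, of `A_{σ,c}`. -/
def basis : Module.Basis (G × Fin D.n) k (GaloisObject D σ c) :=
  Module.Basis.mk (linearIndependent_monomial D σ c) (span_monomial D σ c).ge

theorem basis_apply (p : G × Fin D.n) :
    basis D σ c p = u D σ c p.1 * y D σ c ^ (p.2 : ℕ) := by
  simp [basis, monomial]

/-! ### Colinear comparison of `H` with `A_{σ,c}`, and homogeneous elements. -/

/-- The linear map `H → A_{σ,c}` sending `g y ^ j` to `u_g u_y ^ j` for `j < n`. -/
def monomialMap : MonomialHopf D →ₗ[k] GaloisObject D σ c :=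
  (basis D 1 0).constr k (basis D σ c)

theorem monomialMap_apply (g : G) {j : ℕ} (hj : j < D.n) :
    monomialMap D σ c (MonomialHopf.of D g * MonomialHopf.y D ^ j) = u D σ c g * y D σ c ^ j := by
  have h := (basis D 1 0).constr_basis k (basis D σ c) (g, ⟨j, hj⟩)
  rwa [basis_apply, basis_apply] at h

theorem monomialMap_of (g : G) : monomialMap D σ c (MonomialHopf.of D g) = u D σ c g := by
  simpa using monomialMap_apply D σ c g (j := 0) (Nat.pos_of_ne_zero (n_ne_zero D))

theorem monomialMap_y : monomialMap D σ c (MonomialHopf.y D) = y D σ c := by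
  simpa [u_one, MonomialHopf.of_one] using monomialMap_apply D σ c 1 (j := 1) D.two_le_n

/-- The summands `u_y ⊗ x` and `1 ⊗ y` of the coaction of `u_y` `q`-commute because `yx = q xy`, so
the `q`-binomial formula applies. -/
theorem coactionHom_u_mul_y_pow (g : G) (j : ℕ) :
    coactionHom D σ c (u D σ c g * y D σ c ^ j) = ∑ i ∈ Finset.range (j + 1),
      gauss (D.χ D.x : k) j i • ((u D σ c g * y D σ c ^ i) ⊗ₜ[k]
        (MonomialHopf.of D g * (MonomialHopf.of D D.x ^ i * MonomialHopf.y D ^ (j - i)))) := by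
  rw [map_mul, map_pow, coactionHom_u, coactionHom_y, add_comm,
    add_pow_gauss (q := (D.χ D.x : k)), Finset.mul_sum]
  · refine Finset.sum_congr rfl fun i _ => ?_
    rw [mul_smul_comm]
    simp [Algebra.TensorProduct.tmul_pow]
  · rw [Algebra.TensorProduct.tmul_mul_tmul, Algebra.TensorProduct.tmul_mul_tmul, one_mul,
      mul_one, MonomialHopf.y_mul_of, TensorProduct.tmul_smul]

/-- The coefficients in the coaction of `u_g u_y ^ j` involve neither `σ` nor `c`, and for `j < n`
no exponent of `u_y` reaches `n`. Hence `H` and `A_{σ,c}` have the same coaction on their monomial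
bases. -/
theorem coactionHom_monomialMap (h : MonomialHopf D) :
    coactionHom D σ c (monomialMap D σ c h)
      = TensorProduct.map (monomialMap D σ c) LinearMap.id (MonomialHopf.comulHom D h) := by
  have : (coactionHom D σ c).toLinearMap.comp (monomialMap D σ c)
      = (TensorProduct.map (monomialMap D σ c) LinearMap.id).comp
        (MonomialHopf.comulHom D).toLinearMap := by
    refine (basis D 1 0).ext fun ⟨g, j, hj⟩ => ?_
    simp only [LinearMap.comp_apply, AlgHom.toLinearMap_apply, MonomialHopf.comulHom]
    rw [basis_apply, monomialMap_apply D σ c g hj, coactionHom_u_mul_y_pow,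
      coactionHom_u_mul_y_pow D 1 0, map_sum]
    refine Finset.sum_congr rfl fun i hi => ?_
    rw [map_smul, TensorProduct.map_tmul, monomialMap_apply D σ c g
      (by have := Finset.mem_range.mp hi; omega), LinearMap.id_apply]
  exact LinearMap.congr_fun this h

/-- The linear functional on `A_{σ,c}` with `u_g ↦ 1` and `u_g u_y ^ j ↦ 0` for `0 < j < n`. -/
def augmentation : GaloisObject D σ c →ₗ[k] k :=
  (basis D σ c).constr k fun p => if (p.2 : ℕ) = 0 then 1 else 0

theorem augmentation_apply (g : G) {j : ℕ} (hj : j < D.n) :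
    augmentation D σ c (u D σ c g * y D σ c ^ j) = if j = 0 then 1 else 0 := by
  have h := (basis D σ c).constr_basis k (fun p => if (p.2 : ℕ) = 0 then (1 : k) else 0)
    (g, ⟨j, hj⟩)
  rwa [basis_apply] at h

/-- An element is recovered from its coaction: the augmentation kills every term with a positive
power of `u_y` on the left, and what remains of `u_g u_y ^ j` is `g y ^ j`. In particular a coaction
of the form `a ⊗ g` forces `a` to be a multiple of `u_g`. -/
theorem monomialMap_augmentation (a : GaloisObject D σ c) :
    monomialMap D σ c (TensorProduct.lid k _
      ((augmentation D σ c).rTensor _ (coactionHom D σ c a))) = a := by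
  have : (monomialMap D σ c).comp ((TensorProduct.lid k _).toLinearMap.comp
      (((augmentation D σ c).rTensor _).comp (coactionHom D σ c).toLinearMap))
      = LinearMap.id := by
    refine (basis D σ c).ext fun ⟨g, j, hj⟩ => ?_
    simp only [LinearMap.comp_apply, AlgHom.toLinearMap_apply, LinearEquiv.coe_coe,
      LinearMap.id_apply]
    rw [basis_apply, coactionHom_u_mul_y_pow, map_sum, Finset.sum_eq_single 0]
    · rw [map_smul, LinearMap.rTensor_tmul, augmentation_apply D σ c g
        (Nat.pos_of_ne_zero (n_ne_zero D))]
      simp [gauss_zero, monomialMap_apply D σ c g hj]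
    · intro i hi hi0
      rw [map_smul, LinearMap.rTensor_tmul, augmentation_apply D σ c g
        (by have := Finset.mem_range.mp hi; omega), if_neg hi0]
      simp
    · simp
  exact LinearMap.congr_fun this a

/-- The elements of degree `g` are the multiples of `u_g`. -/
theorem eq_smul_u_of_coactionHom {a : GaloisObject D σ c} {g : G}
    (ha : coactionHom D σ c a = a ⊗ₜ[k] MonomialHopf.of D g) : ∃ t : k, a = t • u D σ c g := by
  refine ⟨augmentation D σ c a, ?_⟩
  have h := monomialMap_augmentation D σ c a
  rw [ha, LinearMap.rTensor_tmul, TensorProduct.lid_tmul, map_smul, monomialMap_of] at h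
  exact h.symm

theorem u_ne_zero (g : G) : u D σ c g ≠ 0 := by
  have h := (basis D σ c).ne_zero (g, ⟨0, Nat.pos_of_ne_zero (n_ne_zero D)⟩)
  simpa [basis_apply] using h

end GaloisObject

/-! ### Comodule algebra maps from the polynomial algebra -/

namespace GaloisObject

variable (D : MonomialDatum k G) (σ : TwoCocycle k G) (c : k)

/-- The comodule algebra map `T(X_H) → A_{σ,c}` that sends every `X_i^h` to `monomialMap h`. -/
def evalHom : PolyAlgebra k (MonomialHopf D) →ₐ[k] GaloisObject D σ c :=
  TensorAlgebra.lift k (Finsupp.lsum k fun _ => monomialMap D σ c)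

theorem evalHom_X (i : ℕ) (h : MonomialHopf D) :
    evalHom D σ c (PolyAlgebra.X k i h) = monomialMap D σ c h := by
  simp [evalHom, PolyAlgebra.X]

/-- Both composites are algebra maps, so colinearity of `monomialMap` on the generators is enough.
-/
theorem isComoduleAlgHom_evalHom :
    IsComoduleAlgHom k (MonomialHopf D) (evalHom D σ c) := by
  refine PolyAlgebra.algHom_ext fun i => LinearMap.ext fun h => ?_
  change coactionHom D σ c (evalHom D σ c (PolyAlgebra.X k i h))
    = Algebra.TensorProduct.map (evalHom D σ c) (AlgHom.id k _)
      (ComoduleAlgebra.coaction (PolyAlgebra.X k i h))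
  rw [evalHom_X, coactionHom_monomialMap, PolyAlgebra.coaction_X, MonomialHopf.comul_eq]
  generalize MonomialHopf.comulHom D h = z
  induction z with
  | zero => simp
  | add a b ha hb => simp only [map_add, ha, hb]
  | tmul a b =>
    rw [TensorProduct.map_tmul, TensorProduct.map_tmul, Algebra.TensorProduct.map_tmul]
    exact congrArg (· ⊗ₜ[k] b) (evalHom_X D σ c i a).symm

variable {D σ c} {μ : PolyAlgebra k (MonomialHopf D) →ₐ[k] GaloisObject D σ c}

theorem coactionHom_map_X (hμ : IsComoduleAlgHom k (MonomialHopf D) μ) (i : ℕ)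
    (h : MonomialHopf D) :
    coactionHom D σ c (μ (PolyAlgebra.X k i h))
      = TensorProduct.map (μ.toLinearMap.comp (PolyAlgebra.Xₗ k _ i)) LinearMap.id
        (MonomialHopf.comulHom D h) := by
  have h1 := DFunLike.congr_fun hμ (PolyAlgebra.X k i h)
  rw [AlgHom.comp_apply, AlgHom.comp_apply, PolyAlgebra.coaction_X, MonomialHopf.comul_eq] at h1
  refine h1.trans ?_
  generalize MonomialHopf.comulHom D h = z
  induction z with
  | zero => simp
  | add a b ha hb => simp only [map_add, ha, hb]
  | tmul a b => simp

/-- As `g` is group-like, the image of `X_i^g` is homogeneous of degree `g`. -/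
theorem exists_map_X_of (hμ : IsComoduleAlgHom k (MonomialHopf D) μ) (i : ℕ) (g : G) :
    ∃ t : k, μ (PolyAlgebra.X k i (MonomialHopf.of D g)) = t • u D σ c g := by
  refine eq_smul_u_of_coactionHom D σ c ?_
  rw [coactionHom_map_X hμ, MonomialHopf.comulHom_of, TensorProduct.map_tmul]
  rfl

/-- The images of `X_i^y` and `t u_y` have the same component `t ⊗ y` in their coactions. Their
difference is therefore homogeneous of degree `x`. -/
theorem exists_map_X_y (hμ : IsComoduleAlgHom k (MonomialHopf D) μ) (i : ℕ) {t : k}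
    (ht : μ (PolyAlgebra.X k i (MonomialHopf.of D 1)) = t • u D σ c 1) :
    ∃ r : k, μ (PolyAlgebra.X k i (MonomialHopf.y D)) = t • y D σ c + r • u D σ c D.x := by
  obtain ⟨r, hr⟩ := eq_smul_u_of_coactionHom D σ c (g := D.x)
    (a := μ (PolyAlgebra.X k i (MonomialHopf.y D)) - t • y D σ c) (by
      have h1 : (μ.toLinearMap.comp (PolyAlgebra.Xₗ k _ i)) 1 = t • 1 := by
        rw [← u_one D σ c, ← ht, MonomialHopf.of_one]; rfl
      rw [map_sub, map_smul, coactionHom_map_X hμ, MonomialHopf.comulHom_y, coactionHom_y,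
        map_add, TensorProduct.map_tmul, TensorProduct.map_tmul, h1, LinearMap.id_apply,
        LinearMap.id_apply, smul_add, TensorProduct.smul_tmul', TensorProduct.smul_tmul',
        add_sub_add_left_eq_sub, ← TensorProduct.sub_tmul]
      rfl)
  exact ⟨r, by rw [← hr]; abel⟩

end GaloisObject

/-! ### Identities that determine the cocycle and the scalar -/

/-- The noncommutative monomial `X_0^{g₁} ⋯ X_0^{gᵣ}`. -/
def wordPoly (D : MonomialDatum k G) (l : List G) : PolyAlgebra k (MonomialHopf D) :=
  (l.map fun g => PolyAlgebra.X k 0 (MonomialHopf.of D g)).prod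

/-- The polynomial `X_0^x X_0^y - X_0^y X_0^x`. -/
def commPoly (D : MonomialDatum k G) : PolyAlgebra k (MonomialHopf D) :=
  PolyAlgebra.X k 0 (MonomialHopf.of D D.x) * PolyAlgebra.X k 0 (MonomialHopf.y D)
    - PolyAlgebra.X k 0 (MonomialHopf.y D) * PolyAlgebra.X k 0 (MonomialHopf.of D D.x)

namespace GaloisObject

variable (D : MonomialDatum k G) (σ σ' : TwoCocycle k G) (c c' : k)

variable {D σ c} in
theorem map_wordPoly {μ : PolyAlgebra k (MonomialHopf D) →ₐ[k] GaloisObject D σ c} {t : G → k}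
    (ht : ∀ g, μ (PolyAlgebra.X k 0 (MonomialHopf.of D g)) = t g • u D σ c g) (l : List G) :
    μ (wordPoly D l) = ((l.map t).prod * σ.word l) • u D σ c l.prod := by
  induction l with
  | nil => simp [wordPoly, TwoCocycle.word, u_one]
  | cons g l ih =>
    simp only [wordPoly, List.map_cons, List.prod_cons, map_mul, TwoCocycle.word,
      Units.val_mul] at ih ⊢
    rw [ht, ih, smul_mul_smul_comm, u_mul, smul_smul]
    congr 1
    ring

/-- The unknown scalars contribute the product of the `t g` over the letters, which is invariant
under permutation. The equal products give the same `u`, so only the values of `σ` on the words have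
to be balanced. -/
theorem wordPoly_mem_identityIdeal {l m : List G} (hp : l.Perm m) (hlm : l.prod = m.prod) :
    (σ.word m : k) • wordPoly D l - (σ.word l : k) • wordPoly D m
      ∈ identityIdeal k (MonomialHopf D) (GaloisObject D σ c) := by
  rw [mem_identityIdeal]
  intro μ hμ
  choose t ht using exists_map_X_of hμ 0
  rw [map_sub, map_smul, map_smul, map_wordPoly ht, map_wordPoly ht, (hp.map t).prod_eq, hlm,
    smul_smul, smul_smul, ← sub_smul]
  rw [show (σ.word m : k) * ((m.map t).prod * σ.word l)
    - σ.word l * ((m.map t).prod * σ.word m) = 0 by ring, zero_smul]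

variable {D c c'}

/-- The identity is tested at `evalHom`, where all unknown scalars are `1`; the relation can be read
off because `u_{l.prod}` is nonzero. -/
theorem word_mul_word_of_le
    (h : identityIdeal k (MonomialHopf D) (GaloisObject D σ c)
      ≤ identityIdeal k (MonomialHopf D) (GaloisObject D σ' c'))
    {l m : List G} (hp : l.Perm m) (hlm : l.prod = m.prod) :
    σ.word l * σ'.word m = σ.word m * σ'.word l := by
  have h1 := (mem_identityIdeal k _).mp (h (wordPoly_mem_identityIdeal D σ c hp hlm))
    (evalHom D σ' c') (isComoduleAlgHom_evalHom D σ' c')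
  have ht : ∀ g, evalHom D σ' c' (PolyAlgebra.X k 0 (MonomialHopf.of D g))
      = (1 : k) • u D σ' c' g := fun g => by rw [evalHom_X, monomialMap_of, one_smul]
  rw [map_sub, map_smul, map_smul, map_wordPoly ht, map_wordPoly ht, hlm, smul_smul, smul_smul,
    ← sub_smul, smul_eq_zero, or_iff_left (u_ne_zero D σ' c' _)] at h1
  apply Units.ext
  simp only [List.map_const', List.prod_replicate, one_pow, one_mul] at h1
  push_cast
  linear_combination -h1

variable (D c)

/-- Each new factor `b` moves past `a ^ i` at the cost of `q ^ i`. The exponent is explicit so that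
the resulting constant is visibly the same for all `σ` and `c`. -/
theorem mul_pow_eq {A : Type*} [Ring A] [Algebra k A] {q : k} {a b : A}
    (h : b * a = q • (a * b)) (m : ℕ) :
    (a * b) ^ m = q ^ (∑ i ∈ Finset.range m, i) • (a ^ m * b ^ m) := by
  induction m with
  | zero => simp
  | succ m ih =>
    rw [pow_succ', ih, mul_smul_comm, mul_assoc, ← mul_assoc b, mul_pow_qcomm h, smul_mul_assoc,
      mul_smul_comm, smul_smul, mul_assoc _ b, ← pow_succ', ← mul_assoc a, ← pow_succ',
      Finset.sum_range_succ, pow_add q]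

/-- The nonzero scalar `(1 - q)ⁿ q^{n (n - 1) / 2}`. -/
def commScalar : k := (1 - (D.χ D.x : k)) ^ D.n * (D.χ D.x : k) ^ (∑ i ∈ Finset.range D.n, i)

theorem commScalar_ne_zero : commScalar D ≠ 0 := by
  refine mul_ne_zero (pow_ne_zero _ (sub_ne_zero.mpr fun h => ?_)) (pow_ne_zero _ (Units.ne_zero _))
  exact D.isPrimitiveRoot.ne_one D.two_le_n h.symm

variable {D σ c} in
-- The term `r u_x` commutes with `u_x` and drops out of the commutator, which leaves `(1 - q) t s
-- u_x u_y`. In its `n`-th power `u_y ^ n` becomes `c`.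
theorem map_commPoly_pow {μ : PolyAlgebra k (MonomialHopf D) →ₐ[k] GaloisObject D σ c} {s t r : k}
    (hx : μ (PolyAlgebra.X k 0 (MonomialHopf.of D D.x)) = s • u D σ c D.x)
    (hy : μ (PolyAlgebra.X k 0 (MonomialHopf.y D)) = t • y D σ c + r • u D σ c D.x) :
    μ (commPoly D ^ D.n) = (c * commScalar D * (t ^ D.n * s ^ D.n)) • u D σ c D.x ^ D.n := by
  have h1 : μ (commPoly D)
      = ((1 - (D.χ D.x : k)) * (t * s)) • (u D σ c D.x * y D σ c) := by
    rw [commPoly, map_sub, map_mul, map_mul, hx, hy]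
    simp only [mul_add, add_mul, smul_mul_smul_comm, y_mul_u, smul_smul]
    rw [mul_comm r s, add_sub_add_right_eq_sub, ← sub_smul]
    congr 1
    ring
  rw [map_pow, h1, smul_pow, mul_pow_eq (y_mul_u D σ c D.x), y_pow,
    ← Algebra.commutes, ← Algebra.smul_def, smul_smul, smul_smul, commScalar, mul_pow, mul_pow]
  congr 1
  ring

/-- The factors `t ^ n` and `s ^ n u_x ^ n` in the value of the commutator power are the values of
`(X^1)^n` and `(X^x)^n`, so the unknown scalars cancel. -/
theorem commPoly_mem_identityIdeal :
    commPoly D ^ D.n - (c * commScalar D) • (PolyAlgebra.X k 0 (MonomialHopf.of D 1) ^ D.n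
      * PolyAlgebra.X k 0 (MonomialHopf.of D D.x) ^ D.n)
      ∈ identityIdeal k (MonomialHopf D) (GaloisObject D σ c) := by
  rw [mem_identityIdeal]
  intro μ hμ
  obtain ⟨t, ht⟩ := exists_map_X_of hμ 0 1
  obtain ⟨s, hs⟩ := exists_map_X_of hμ 0 D.x
  obtain ⟨r, hr⟩ := exists_map_X_y hμ 0 ht
  rw [map_sub, map_commPoly_pow hs hr, map_smul, map_mul, map_pow, map_pow, ht, hs, u_one,
    smul_pow, smul_pow, one_pow, smul_mul_smul_comm, one_mul, smul_smul, sub_self]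

theorem u_pow_ne_zero (g : G) (m : ℕ) : u D σ c g ^ m ≠ 0 := by
  have h : ∃ s : kˣ, u D σ c g ^ m = (s : k) • u D σ c (g ^ m) := by
    induction m with
    | zero => exact ⟨1, by simp [u_one]⟩
    | succ m ih =>
      obtain ⟨s, hs⟩ := ih
      refine ⟨s * σ (g ^ m) g, ?_⟩
      rw [pow_succ, hs, smul_mul_assoc, u_mul, smul_smul, Units.val_mul, pow_succ]
  obtain ⟨s, hs⟩ := h
  rw [hs]
  exact smul_ne_zero s.ne_zero (u_ne_zero D σ c _)

variable {D c}

/-- At `evalHom`, with `s = t = 1` and `r = 0`, the identity reads `(c' - c) · commScalar · u_x ^ n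
= 0`, and the last two factors are nonzero. -/
theorem scalar_eq_of_le
    (h : identityIdeal k (MonomialHopf D) (GaloisObject D σ c)
      ≤ identityIdeal k (MonomialHopf D) (GaloisObject D σ' c')) : c = c' := by
  have h1 := (mem_identityIdeal k _).mp (h (commPoly_mem_identityIdeal D σ c))
    (evalHom D σ' c') (isComoduleAlgHom_evalHom D σ' c')
  have hx : evalHom D σ' c' (PolyAlgebra.X k 0 (MonomialHopf.of D D.x))
      = (1 : k) • u D σ' c' D.x := by rw [evalHom_X, monomialMap_of, one_smul]
  have hy : evalHom D σ' c' (PolyAlgebra.X k 0 (MonomialHopf.y D))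
      = (1 : k) • y D σ' c' + (0 : k) • u D σ' c' D.x := by
    rw [evalHom_X, monomialMap_y, one_smul, zero_smul, add_zero]
  rw [map_sub, map_commPoly_pow hx hy, map_smul, map_mul, map_pow, map_pow, hx, evalHom_X,
    monomialMap_of, u_one, one_pow, one_pow, one_mul, one_smul, mul_one, one_mul,
    ← sub_smul,
    smul_eq_zero, or_iff_left (u_pow_ne_zero D σ' c' _ _), ← sub_mul, mul_eq_zero,
    or_iff_left (commScalar_ne_zero D), sub_eq_zero] at h1
  exact h1.symm

/-! ### Cohomologous cocycles give isomorphic comodule algebras -/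

variable {σ σ'} in
/-- The algebra map `A_{σ,c} → A_{σ',c}` given by `u_g ↦ f(g) u_g`, `u_y ↦ u_y` when `σ` and `σ'`
differ by the coboundary of `f`. -/
def rescale (f : G → kˣ) (hf : ∀ g h : G, σ g h = f g * f h * (f (g * h))⁻¹ * σ' g h) :
    GaloisObject D σ c →ₐ[k] GaloisObject D σ' c :=
  lift (fun g => (f g : k) • u D σ' c g) (y D σ' c)
    (by
      -- Normalization of both cocycles forces `f 1 = 1`.
      have h := hf 1 1
      simp only [σ.map_one_one, σ'.map_one_one, mul_one, mul_inv_cancel_right] at h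
      rw [← h, u_one, Units.val_one, one_smul])
    (by
      intro g h
      rw [smul_mul_smul_comm, u_mul, smul_smul, smul_smul]
      congr 1
      rw [← Units.val_mul, ← Units.val_mul, ← Units.val_mul, hf]
      congr 1
      calc f g * f h * σ' g h = f g * f h * σ' g h * ((f (g * h))⁻¹ * f (g * h)) := by simp
        _ = _ := by ac_rfl)
    (y_pow D σ' c)
    (by
      intro g
      rw [mul_smul_comm, y_mul_u, smul_mul_assoc, smul_comm])

theorem isomorphic_of_cohomologous (h : σ.Cohomologous σ') :
    IsomorphicComoduleAlgebras k (MonomialHopf D) (GaloisObject D σ c) (GaloisObject D σ' c) := by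
  obtain ⟨f, hf⟩ := h
  -- The inverse isomorphism is the rescaling by `f⁻¹`, whose coboundary turns `σ` into `σ'`.
  have hf' : ∀ g h : G, σ' g h
      = (f g)⁻¹ * (f h)⁻¹ * ((f (g * h))⁻¹)⁻¹ * σ g h := by
    intro g h
    rw [hf g h, inv_inv]
    calc σ' g h = (f g)⁻¹ * f g * ((f h)⁻¹ * f h) * (f (g * h) * (f (g * h))⁻¹) * σ' g h := by simp
      _ = _ := by ac_rfl
  refine ⟨AlgEquiv.ofAlgHom (rescale f hf) (rescale (fun g => (f g)⁻¹) hf') ?_ ?_, ?_⟩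
  · apply algHom_ext
    · intro g; simp [rescale, smul_smul]
    · simp [rescale]
  · apply algHom_ext
    · intro g; simp [rescale, smul_smul]
    · simp [rescale]
  · apply algHom_ext
    · intro g
      change coactionHom D σ' c (rescale f hf (u D σ c g)) = Algebra.TensorProduct.map
        (rescale f hf) (AlgHom.id k _) (coactionHom D σ c (u D σ c g))
      simp [rescale, TensorProduct.smul_tmul']
    · change coactionHom D σ' c (rescale f hf (y D σ c)) = Algebra.TensorProduct.map
        (rescale f hf) (AlgHom.id k _) (coactionHom D σ c (y D σ c))
      simp [rescale]

end GaloisObject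

end HopfPI

end

theorem theorem3p3 {k G : Type*} [Field k] [IsAlgClosed k] [Group G] [Finite G]
    (D : HopfPI.MonomialDatum k G) (σ σ' : HopfPI.TwoCocycle k G) (c c' : k)
    (hId : HopfPI.identityIdeal k (HopfPI.MonomialHopf D) (HopfPI.GaloisObject D σ c) =
      HopfPI.identityIdeal k (HopfPI.MonomialHopf D) (HopfPI.GaloisObject D σ' c')) :
    HopfPI.IsomorphicComoduleAlgebras k (HopfPI.MonomialHopf D)
        (HopfPI.GaloisObject D σ c) (HopfPI.GaloisObject D σ' c') ∧
      c = c' ∧ σ.Cohomologous σ' := by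
  have hσ : σ.Cohomologous σ' := σ.cohomologous_of_word σ' fun l m hp hlm =>
    HopfPI.GaloisObject.word_mul_word_of_le σ σ' hId.le hp hlm
  -- The scalars are identified before the isomorphism is built, since rescaling fixes `u_y` and
  -- needs a common `c`.
  obtain rfl := HopfPI.GaloisObject.scalar_eq_of_le σ σ' hId.le
  exact ⟨HopfPI.GaloisObject.isomorphic_of_cohomologous σ σ' hσ, rfl, hσ⟩
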